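/- Let $p$ be a prime, let $k\ge 1$ be an integer, and let $F$ be a field containing a primitive $p^k$-th root of unity $\zeta_{p^k}$. Let $G_F=\mathrm{Gal}(F_{sep}/F)$ be the absolute Galois group of $F$, let $G_F(p)$ be its maximal pro-$p$ quotient, and let $G_F(p)^{ab}$ be the quotient of $G_F(p)$ by the closure of its commutator subgroup. Suppose that the torsion subgroup $$\mathrm{Tor}(G_F(p)^{ab})=\{\sigma\in G_F(p)^{ab}\mid \sigma^{n}=1\text{ for some integer } n\ge 1\}$$ is closed in $G_F(p)^{ab}$. Then there exist a set $J$, an integer $l\ge 0$, cardinal numbers $m(1),\dots,m(l)$ and integers $s_1,\dots,s_l$ with $k\le s_1<s_2<\cdots<s_l$ such that there is an isomorphism of topological groups $$G_F(p)^{ab}\;\cong\;\prod_{J}\mathbb{Z}_p\;\times\;\prod_{i=1}^{l}\ \prod_{m(i)}\mathbb{Z}/p^{s_i}\mathbb{Z},$$ where $\mathbb{Z}_p$ has its $p$-adic topology, each $\mathbb{Z}/p^{s_i}\mathbb{Z}$ is discrete, and products have the product topology. -/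

import Mathlib

universe u

noncomputable section

/-- The intersection of all open normal subgroups of `p`-power index of a topological group `G`. -/
def proPKernel (p : ℕ) (G : Type*) [Group G] [TopologicalSpace G] : Subgroup G :=
  ⨅ U : {U : OpenNormalSubgroup G // ∃ n : ℕ, (U : Subgroup G).index = p ^ n},
    (U.1 : Subgroup G)

instance proPKernel_normal (p : ℕ) (G : Type*) [Group G] [TopologicalSpace G] :
    (proPKernel p G).Normal :=
  Subgroup.normal_iInf_normal fun U => U.1.isNormal'

/-- The maximal pro-`p` quotient of a profinite group `G`, with the quotient topology. -/
abbrev MaximalProPQuotient (p : ℕ) (G : Type*) [Group G] [TopologicalSpace G] : Type _ :=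
  G ⧸ proPKernel p G

/-- The group `G_F(p)`: the maximal pro-`p` quotient of the absolute Galois group
`Gal(F_sep / F)`, the latter with its Krull topology. -/
abbrev maximalProPGaloisGroup (p : ℕ) (F : Type*) [Field F] : Type _ :=
  MaximalProPQuotient p (Gal(SeparableClosure F/F))

/-- The profinite abelianization `G_F(p)^{ab}`: the quotient of `G_F(p)` by the closure of its
commutator subgroup. -/
abbrev maximalProPGaloisGroupAb (p : ℕ) (F : Type*) [Field F] : Type _ :=
  TopologicalAbelianization (maximalProPGaloisGroup p F)

end

/-!
Let `B` be the abelian pro-`p` group in question, written additively, and filter its `ZMod p`-dual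
`V` by liftability: the `n`-th step consists of the characters which lift to `ZMod (p ^ (n + 1))`.
If the torsion of `B` is closed, it is compact, so by Baire's theorem it has bounded exponent.
Hence a character which lifts far enough vanishes on the torsion, and it then lifts to `ℤ_[p]`
because the quotient of `B` by its torsion is torsion-free and `ZMod (p ^ n)` is injective over
itself. So the filtration becomes stationary. By Hilbert 90 and Kummer theory, a primitive
`p ^ k`-th root of unity makes every character lift to `ZMod (p ^ k)`.

Take a basis of `V` adapted to the filtration and lift each basis vector as far as it goes, to
`ZMod (p ^ s)` or to `ℤ_[p]`. Together the lifts form a homomorphism `Φ` from `B` to a product. It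
is surjective because it is so modulo `p`, by linear independence and compactness. It is injective
because on the closed subgroup where `Φ` vanishes every homomorphism `B → ZMod (p ^ n)` vanishes
too, by induction on `n`.
-/

open Topology

@[to_additive]
lemma monoidHom_continuous_of_isOpen_ker {G H : Type*} [Group G] [TopologicalSpace G]
    [IsTopologicalGroup G] [Group H] [TopologicalSpace H] [IsTopologicalGroup H]
    [DiscreteTopology H] (f : G →* H) (hf : IsOpen (f.ker : Set G)) : Continuous f := by
  refine continuous_of_continuousAt_one f ?_
  rw [ContinuousAt, map_one, nhds_discrete H, Filter.tendsto_pure]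
  exact hf.mem_nhds (one_mem f.ker)

@[to_additive]
lemma nonarchimedeanGroup_of_isOpenMap {G H : Type*} [Group G] [TopologicalSpace G]
    [NonarchimedeanGroup G] [Group H] [TopologicalSpace H] [IsTopologicalGroup H] (f : G →* H)
    (hf : Continuous f) (hf' : IsOpenMap f) : NonarchimedeanGroup H where
  is_nonarchimedean V hV := by
    obtain ⟨U, hU⟩ := NonarchimedeanGroup.is_nonarchimedean (f ⁻¹' V)
      (hf.continuousAt.preimage_mem_nhds (by rwa [map_one]))
    exact ⟨⟨U.toSubgroup.map f, hf' _ U.isOpen⟩, Set.image_subset_iff.2 hU⟩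

section ZModDuality

lemma zmod_baer (n : ℕ) [NeZero n] : Module.Baer (ZMod n) (ZMod n) := by
  intro I g
  have : IsPrincipalIdealRing (ZMod n) :=
    .of_surjective (Int.castRingHom (ZMod n)) ZMod.intCast_surjective
  obtain ⟨a, rfl⟩ := (IsPrincipalIdealRing.principal I).principal
  obtain ⟨a, rfl⟩ := ZMod.natCast_zmod_surjective a
  have ha : (a : ZMod n) ∈ Ideal.span {(a : ZMod n)} := Ideal.mem_span_singleton_self _
  obtain ⟨y, hy⟩ := ZMod.natCast_zmod_surjective (g ⟨a, ha⟩)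
  have hdvd : a.gcd n ∣ y := by
    obtain ⟨e, he⟩ := a.gcd_dvd_right n
    obtain ⟨b, hb⟩ := a.gcd_dvd_left n
    have hea : e • (⟨a, ha⟩ : Ideal.span {(a : ZMod n)}) = 0 := Subtype.ext <| by
      change e • (a : ZMod n) = 0
      rw [nsmul_eq_mul, ← Nat.cast_mul, ZMod.natCast_eq_zero_iff]
      exact ⟨b, by nth_rw 1 [hb]; nth_rw 2 [he]; ring⟩
    have hey : e • g ⟨a, ha⟩ = 0 := by rw [← map_nsmul, hea, map_zero]
    rw [← hy, nsmul_eq_mul, ← Nat.cast_mul, ZMod.natCast_eq_zero_iff] at hey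
    have he0 : 0 < e := Nat.pos_of_ne_zero (by rintro rfl; exact NeZero.ne n he)
    exact Nat.dvd_of_mul_dvd_mul_left he0 (by rwa [mul_comm, ← he])
  obtain ⟨z, rfl⟩ := hdvd
  have hbezout : (a.gcd n : ZMod n) = a.gcdA n * a := by
    have := congrArg (Int.cast : ℤ → ZMod n) (a.gcd_eq_gcd_ab n)
    push_cast at this
    rw [this, ZMod.natCast_self, zero_mul, add_zero, mul_comm]
  refine ⟨LinearMap.toSpanSingleton (ZMod n) (ZMod n) (a.gcdA n * z), fun x hx => ?_⟩
  obtain ⟨c, rfl⟩ := Ideal.mem_span_singleton'.1 hx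
  rw [show (⟨c * a, hx⟩ : Ideal.span {(a : ZMod n)}) = c • ⟨a, ha⟩ from rfl, map_smul, ← hy,
    Nat.cast_mul, hbezout, LinearMap.toSpanSingleton_apply, smul_eq_mul, smul_eq_mul]
  ring

lemma exists_zmodHom_comp_eq {n : ℕ} [NeZero n] {A Q : Type*} [AddCommGroup A] [AddCommGroup Q]
    (hQ : ∀ x : Q, n • x = 0) (h : A →+ Q) (f : A →+ ZMod n) (hf : h.ker ≤ f.ker) :
    ∃ g : Q →+ ZMod n, g.comp h = f := by
  let _ : Module (ZMod n) Q := AddCommGroup.zmodModule hQ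
  let _ : Module (ZMod n) (A ⧸ h.ker) := AddCommGroup.zmodModule fun x =>
    QuotientAddGroup.kerLift_injective h (by rw [map_nsmul, hQ, map_zero])
  obtain ⟨g, hg⟩ := (zmod_baer n).extension_property
    ((QuotientAddGroup.kerLift h).toZModLinearMap n) (QuotientAddGroup.kerLift_injective h)
    ((QuotientAddGroup.lift h.ker f hf).toZModLinearMap n)
  exact ⟨g.toAddMonoidHom, AddMonoidHom.ext fun a => LinearMap.congr_fun hg (a : A ⧸ h.ker)⟩

lemma exists_zmodHom_ne_zero {n : ℕ} [NeZero n] {Q : Type*} [AddCommGroup Q]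
    (hQ : ∀ x : Q, n • x = 0) {x : Q} (hx : x ≠ 0) : ∃ g : Q →+ ZMod n, g x ≠ 0 := by
  obtain ⟨e, he⟩ := addOrderOf_dvd_of_nsmul_eq_zero (hQ x)
  obtain ⟨g, hg⟩ := exists_zmodHom_comp_eq hQ (zmultiplesHom Q x)
    (zmultiplesHom (ZMod n) (e : ZMod n)) fun i hi => by
      rw [AddMonoidHom.mem_ker, zmultiplesHom_apply] at hi ⊢
      obtain ⟨j, rfl⟩ := addOrderOf_dvd_iff_zsmul_eq_zero.2 hi
      rw [mul_comm, mul_zsmul, natCast_zsmul, nsmul_eq_mul, ← Nat.cast_mul, ← he,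
        ZMod.natCast_self, smul_zero]
  have hgx : g x = e := by simpa using DFunLike.congr_fun hg 1
  refine ⟨g, fun h => hx (AddMonoid.addOrderOf_eq_one_iff.1 ?_)⟩
  rw [hgx, ZMod.natCast_eq_zero_iff] at h
  have he0 : 0 < e := Nat.pos_of_ne_zero (by rintro rfl; exact NeZero.ne n he)
  rw [he] at h
  exact Nat.dvd_one.1 (Nat.dvd_of_mul_dvd_mul_right he0 (by simpa using h))

/-- The homomorphism `ZMod m → ZMod n` sending `1` to `d`, where `n = m * d`. -/
def zmodMulHom {m d n : ℕ} (h : m * d = n) : ZMod m →+ ZMod n :=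
  ZMod.lift m ⟨zmultiplesHom _ (d : ZMod n), by
    rw [zmultiplesHom_apply, natCast_zsmul, nsmul_eq_mul, ← Nat.cast_mul, h, ZMod.natCast_self]⟩

lemma zmodMulHom_castHom {m d n : ℕ} (h : m * d = n) (x : ZMod n) :
    zmodMulHom h (ZMod.castHom (Dvd.intro d h) (ZMod m) x) = d • x := by
  obtain ⟨x, rfl⟩ := ZMod.intCast_surjective x
  rw [map_intCast, zmodMulHom, ZMod.lift_coe]
  simp [mul_comm]

lemma zmodMulHom_injective {m d n : ℕ} (h : m * d = n) (hd : d ≠ 0) :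
    Function.Injective (zmodMulHom h) := by
  refine (ZMod.lift_injective _).2 fun i hi => ?_
  rw [zmultiplesHom_apply, zsmul_eq_mul, ← Int.cast_natCast d, ← Int.cast_mul,
    ZMod.intCast_zmod_eq_zero_iff_dvd, ← h, Nat.cast_mul] at hi
  exact (ZMod.intCast_zmod_eq_zero_iff_dvd i m).2
    (Int.dvd_of_mul_dvd_mul_right (Nat.cast_ne_zero.2 hd) hi)

end ZModDuality

section Reductions

/-- Reduction `ZMod n → ZMod m` for `m ∣ n`, as a continuous `ℤ`-linear map. -/
def zmodReduction {m n : ℕ} (h : m ∣ n) : ZMod n →L[ℤ] ZMod m where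
  toLinearMap := (ZMod.castHom h (ZMod m)).toAddMonoidHom.toIntLinearMap
  cont := continuous_of_discreteTopology

lemma zmodReduction_apply {m n : ℕ} (h : m ∣ n) (x : ZMod n) :
    zmodReduction h x = ZMod.castHom h (ZMod m) x := rfl

lemma zmodReduction_zmodReduction {l m n : ℕ} (h : l ∣ m) (h' : m ∣ n) (x : ZMod n) :
    zmodReduction h (zmodReduction h' x) = zmodReduction (h.trans h') x :=
  DFunLike.congr_fun (ZMod.castHom_comp h h') x

lemma exists_nsmul_eq_of_zmodReduction_eq_zero {m n : ℕ} (h : m ∣ n) {x : ZMod n}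
    (hx : zmodReduction h x = 0) : ∃ y, m • y = x := by
  obtain ⟨x, rfl⟩ := ZMod.intCast_surjective x
  rw [zmodReduction_apply, map_intCast, ZMod.intCast_zmod_eq_zero_iff_dvd] at hx
  obtain ⟨y, rfl⟩ := hx
  exact ⟨(y : ZMod n), by simp⟩

variable {p : ℕ} [Fact p.Prime]

/-- Reduction `ℤ_[p] → ZMod (p ^ n)`, as a continuous `ℤ`-linear map. -/
noncomputable def padicReduction (p : ℕ) [Fact p.Prime] (n : ℕ) : ℤ_[p] →L[ℤ] ZMod (p ^ n) where
  toLinearMap := (PadicInt.toZModPow n).toAddMonoidHom.toIntLinearMap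
  cont := by
    refine addMonoidHom_continuous_of_isOpen_ker (PadicInt.toZModPow n).toAddMonoidHom ?_
    have hp : (p : ℝ) ^ (-n : ℤ) ≠ 0 :=
      zpow_ne_zero _ (Nat.cast_ne_zero.2 (Fact.out : p.Prime).ne_zero)
    convert IsUltrametricDist.isOpen_closedBall (0 : ℤ_[p]) hp
    ext x
    rw [mem_closedBall_zero_iff, PadicInt.norm_le_pow_iff_mem_span_pow, ← PadicInt.ker_toZModPow]
    rfl

lemma padicReduction_apply (n : ℕ) (x : ℤ_[p]) :
    padicReduction p n x = PadicInt.toZModPow n x := rfl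

lemma eq_of_forall_padicReduction_eq {x y : ℤ_[p]}
    (h : ∀ n, padicReduction p n x = padicReduction p n y) : x = y :=
  PadicInt.ext_of_toZModPow.1 h

lemma zmodReduction_padicReduction {m n : ℕ} (h : m ≤ n) (x : ℤ_[p]) :
    zmodReduction (pow_dvd_pow p h) (padicReduction p n x) = padicReduction p m x :=
  DFunLike.congr_fun (PadicInt.zmod_cast_comp_toZModPow m n h) x

/-- The residue map `ℤ_[p] → ZMod p`, as a continuous `ℤ`-linear map. -/
noncomputable def padicResidue (p : ℕ) [Fact p.Prime] : ℤ_[p] →L[ℤ] ZMod p :=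
  (zmodReduction (dvd_pow_self p one_ne_zero)).comp (padicReduction p 1)

lemma zmodReduction_padicReduction_succ (n : ℕ) (x : ℤ_[p]) :
    zmodReduction (dvd_pow_self p n.succ_ne_zero) (padicReduction p (n + 1) x) =
      padicResidue p x := by
  rw [padicResidue, ContinuousLinearMap.comp_apply,
    ← zmodReduction_padicReduction (Nat.le_add_left 1 n), zmodReduction_zmodReduction]

lemma exists_nsmul_eq_of_padicResidue_eq_zero {x : ℤ_[p]} (hx : padicResidue p x = 0) :
    ∃ y, p • y = x := by
  obtain ⟨z, hz⟩ := exists_nsmul_eq_of_zmodReduction_eq_zero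
    (dvd_pow_self p one_ne_zero) hx
  have hx1 : PadicInt.toZModPow 1 x = 0 := by
    rw [← padicReduction_apply]
    refine hz.symm.trans ?_
    rw [nsmul_eq_mul, ZMod.natCast_eq_zero_iff p _ |>.2 (by simp),
      zero_mul]
  rw [← RingHom.mem_ker, PadicInt.ker_toZModPow, pow_one, Ideal.mem_span_singleton] at hx1
  obtain ⟨y, rfl⟩ := hx1
  exact ⟨y, nsmul_eq_mul p y⟩

lemma exists_forall_padicReduction_eq (a : ∀ n, ZMod (p ^ n))
    (ha : ∀ n, zmodReduction (pow_dvd_pow p n.le_succ) (a (n + 1)) = a n) :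
    ∃ x : ℤ_[p], ∀ n, padicReduction p n x = a n := by
  have hdvd : ∀ i, (p : ℤ) ^ i ∣ ((a (i + 1)).val : ℤ) - ((a i).val : ℤ) := fun i => by
    rw [← Nat.cast_pow, ← ZMod.intCast_eq_intCast_iff_dvd_sub]
    have h := ha i
    rw [zmodReduction_apply, ← ZMod.natCast_zmod_val (a (i + 1)), map_natCast] at h
    rw [Int.cast_natCast, Int.cast_natCast, h, ZMod.natCast_zmod_val]
  refine ⟨PadicInt.ofIntSeq _ (PadicInt.isCauSeq_padicNorm_of_pow_dvd_sub
    (fun i => ((a i).val : ℤ)) p hdvd), fun n => ?_⟩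
  rw [padicReduction_apply, PadicInt.toZModPow_ofIntSeq_of_pow_dvd_sub _ _ hdvd]
  simp

lemma padicInt_continuous_of_forall_padicReduction {X : Type*} [TopologicalSpace X]
    {φ : X → ℤ_[p]} (h : ∀ n, Continuous fun x => padicReduction p n (φ x)) :
    Continuous φ := by
  refine continuous_iff_continuousAt.2 fun x => Metric.tendsto_nhds.2 fun ε hε => ?_
  obtain ⟨n, hn⟩ := PadicInt.exists_pow_neg_lt p hε
  filter_upwards [(h n).continuousAt.eventually_mem
    ((isOpen_discrete {padicReduction p n (φ x)}).mem_nhds rfl)] with y hy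
  refine lt_of_le_of_lt ?_ hn
  rw [dist_eq_norm, PadicInt.norm_le_pow_iff_mem_span_pow, ← PadicInt.ker_toZModPow,
    RingHom.mem_ker, map_sub, sub_eq_zero]
  exact hy

end Reductions

section Lifting

variable {B : Type*} [AddCommGroup B] [TopologicalSpace B]

instance nonarchimedeanAddGroup_quotient [NonarchimedeanAddGroup B] (C : AddSubgroup B) :
    NonarchimedeanAddGroup (B ⧸ C) :=
  nonarchimedeanAddGroup_of_isOpenMap (QuotientAddGroup.mk' C) QuotientAddGroup.continuous_mk
    QuotientAddGroup.isOpenMap_coe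

lemma exists_openAddSubgroup_forall_nsmul_mem [NonarchimedeanAddGroup B] [CompactSpace B]
    [T2Space B] {m d : ℕ} (f : B →L[ℤ] ZMod m) (hf : ∀ b, d • b = 0 → f b = 0) :
    ∃ U : OpenAddSubgroup B, ∀ b, d • b ∈ U → f b = 0 := by
  have hK : IsClosed ((d • ·) '' {b | f b ≠ 0}) :=
    (((isClosed_discrete {0}ᶜ).preimage f.continuous).isCompact.image
      (continuous_nsmul d)).isClosed
  obtain ⟨U, hU⟩ := NonarchimedeanAddGroup.is_nonarchimedean _
    (hK.isOpen_compl.mem_nhds (x := 0) fun ⟨b, hb, hdb⟩ => hb (hf b hdb))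
  exact ⟨U, fun b hb => by_contra fun hfb => hU hb ⟨b, hfb, rfl⟩⟩

lemma exists_openAddSubgroup_nsmul_mem_of_mul_eq [NonarchimedeanAddGroup B] [CompactSpace B]
    [T2Space B] {m d n : ℕ} (h : m * d = n) (f : B →L[ℤ] ZMod m)
    (hf : ∀ b, d • b = 0 → f b = 0) :
    ∃ U : OpenAddSubgroup B, (∀ b, n • b ∈ U) ∧ ∀ b, d • b ∈ U → f b = 0 := by
  obtain ⟨U, hU⟩ := exists_openAddSubgroup_forall_nsmul_mem f hf
  refine ⟨⟨U.toAddSubgroup ⊔ (nsmulAddMonoidHom n).range,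
    AddSubgroup.isOpen_mono (le_sup_left : U.toAddSubgroup ≤ _) U.isOpen⟩,
    fun b => AddSubgroup.mem_sup_right ⟨b, rfl⟩, fun b hb => ?_⟩
  obtain ⟨u, hu, _, ⟨c, rfl⟩, huc⟩ := AddSubgroup.mem_sup.1 hb
  have hbc : d • (b - m • c) ∈ U := by
    rw [nsmul_sub, ← mul_nsmul, h, ← huc]
    simpa using hu
  have hfbc := hU _ hbc
  rwa [map_sub, map_nsmul, nsmul_eq_mul, ZMod.natCast_self, zero_mul, sub_zero] at hfbc

lemma exists_zmodReduction_comp_eq [NonarchimedeanAddGroup B] [CompactSpace B] [T2Space B]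
    {m d n : ℕ} (h : m * d = n) (hn : n ≠ 0) (f : B →L[ℤ] ZMod m)
    (hf : ∀ b, d • b = 0 → f b = 0) :
    ∃ g : B →L[ℤ] ZMod n, (zmodReduction (Dvd.intro d h)).comp g = f := by
  -- On a suitable discrete quotient killed by `n`, the assignment `d • b ↦ d * f b` is well defined
  -- with values in `ZMod n`, and it extends because `ZMod n` is an injective module over itself.
  have : NeZero n := ⟨hn⟩
  obtain ⟨U, hnU, hU⟩ := exists_openAddSubgroup_nsmul_mem_of_mul_eq h f hf
  let q := QuotientAddGroup.mk' U.toAddSubgroup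
  have hq : ∀ x : B ⧸ U.toAddSubgroup, n • x = 0 := fun x => by
    obtain ⟨b, rfl⟩ := QuotientAddGroup.mk'_surjective _ x
    rw [← map_nsmul]
    exact (QuotientAddGroup.eq_zero_iff _).2 (hnU b)
  obtain ⟨g, hg⟩ := exists_zmodHom_comp_eq hq (q.comp (nsmulAddMonoidHom d))
    ((zmodMulHom h).comp (f : B →+ ZMod m)) fun b hb => by
      have hfb : f b = 0 := hU b ((QuotientAddGroup.eq_zero_iff _).1 hb)
      exact (congrArg (zmodMulHom h) hfb).trans (map_zero _)
  have := QuotientAddGroup.discreteTopology U.isOpen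
  refine ⟨⟨(g.comp q).toIntLinearMap,
      (continuous_of_discreteTopology (f := g)).comp QuotientAddGroup.continuous_mk⟩,
    ContinuousLinearMap.ext fun b => zmodMulHom_injective h ?_ ?_⟩
  · rintro rfl
    exact hn (by rw [← h, mul_zero])
  · rw [ContinuousLinearMap.comp_apply, zmodReduction_apply, zmodMulHom_castHom]
    change d • g (q b) = _
    rw [← map_nsmul, ← map_nsmul]
    exact DFunLike.congr_fun hg b

variable {p : ℕ} [Fact p.Prime]

lemma exists_padicHom_of_compatible (f : ∀ n, B →L[ℤ] ZMod (p ^ n))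
    (hf : ∀ n, (zmodReduction (pow_dvd_pow p n.le_succ)).comp (f (n + 1)) = f n) :
    ∃ φ : B →L[ℤ] ℤ_[p], ∀ n, (padicReduction p n).comp φ = f n := by
  choose φ hφ using fun b => exists_forall_padicReduction_eq (fun n => f n b)
    fun n => DFunLike.congr_fun (hf n) b
  let φ' : B →+ ℤ_[p] := AddMonoidHom.mk' φ fun a b => eq_of_forall_padicReduction_eq fun n => by
    rw [map_add, hφ, hφ, hφ, map_add]
  exact ⟨⟨φ'.toIntLinearMap, padicInt_continuous_of_forall_padicReduction fun n =>
    (f n).continuous.congr fun b => (hφ b n).symm⟩,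
    fun n => ContinuousLinearMap.ext fun b => hφ b n⟩

lemma exists_padicResidue_comp_eq [NonarchimedeanAddGroup B] [CompactSpace B] [T2Space B]
    (hB : ∀ b : B, p • b = 0 → b = 0) (f : B →L[ℤ] ZMod p) :
    ∃ φ : B →L[ℤ] ℤ_[p], (padicResidue p).comp φ = f := by
  have hlift (n : ℕ) (g : B →L[ℤ] ZMod (p ^ n)) : ∃ g' : B →L[ℤ] ZMod (p ^ (n + 1)),
      (zmodReduction (pow_dvd_pow p n.le_succ)).comp g' = g :=
    exists_zmodReduction_comp_eq (pow_succ p n).symm (pow_ne_zero _ (Fact.out : p.Prime).ne_zero) g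
      fun b hb => by rw [hB b hb, map_zero]
  choose lift hlift using hlift
  let f₁ : B →L[ℤ] ZMod (p ^ 1) := (zmodReduction (pow_one p).dvd).comp f
  let g : ∀ n, B →L[ℤ] ZMod (p ^ (n + 1)) := fun n => Nat.rec f₁ (fun n => lift (n + 1)) n
  have hg (n : ℕ) (b : B) : zmodReduction (pow_dvd_pow p (n + 1).le_succ) (g (n + 1) b) = g n b :=
    DFunLike.congr_fun (hlift (n + 1) (g n)) b
  obtain ⟨φ, hφ⟩ := exists_padicHom_of_compatible
    (fun n => (zmodReduction (pow_dvd_pow p n.le_succ)).comp (g n)) fun n => by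
      ext b
      simp only [ContinuousLinearMap.comp_apply, hg]
  refine ⟨φ, ContinuousLinearMap.ext fun b => ?_⟩
  have hφb : padicReduction p 1 (φ b) = g 0 b := (DFunLike.congr_fun (hφ 1) b).trans (hg 0 b)
  rw [padicResidue, ContinuousLinearMap.comp_apply, ContinuousLinearMap.comp_apply, hφb]
  change zmodReduction (dvd_pow_self p one_ne_zero) (zmodReduction (pow_one p).dvd (f b)) = f b
  rw [zmodReduction_zmodReduction, zmodReduction_apply, ZMod.castHom_self, RingHom.id_apply]

end Lifting

section Torsion

lemma exists_pos_forall_nsmul_eq_zero_of_isAddTorsion {A : Type*} [AddCommGroup A]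
    [TopologicalSpace A] [IsTopologicalAddGroup A] [CompactSpace A] [T2Space A]
    (hA : IsAddTorsion A) : ∃ m : ℕ, 0 < m ∧ ∀ a : A, m • a = 0 := by
  let K : ℕ → AddSubgroup A := fun n => (nsmulAddMonoidHom (α := A) (n + 1)).ker
  have hK_closed : ∀ n, IsClosed (K n : Set A) := fun n =>
    isClosed_singleton.preimage (continuous_nsmul (n + 1))
  have hK_cover : ⋃ n, (K n : Set A) = Set.univ := Set.eq_univ_of_forall fun a => by
    obtain ⟨n, hn, hna⟩ := isOfFinAddOrder_iff_nsmul_eq_zero.1 (hA a)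
    obtain ⟨n, rfl⟩ := Nat.exists_eq_add_of_lt hn
    exact Set.mem_iUnion.2 ⟨n, by simpa [K] using hna⟩
  obtain ⟨n, x, hx⟩ := nonempty_interior_of_iUnion_of_closed hK_closed hK_cover
  have hK_open : IsOpen (K n : Set A) :=
    AddSubgroup.isOpen_of_mem_nhds _ (mem_interior_iff_mem_nhds.1 hx)
  have : Finite (A ⧸ K n) := AddSubgroup.quotient_finite_of_isOpen (K n) hK_open
  have : (K n).FiniteIndex := AddSubgroup.finiteIndex_of_finite_quotient
  refine ⟨(n + 1) * (K n).index, Nat.mul_pos n.succ_pos (Nat.pos_of_ne_zero this.index_ne_zero),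
    fun a => ?_⟩
  rw [mul_smul]
  exact AddSubgroup.nsmul_index_mem (K n) a

variable {p : ℕ} [Fact p.Prime]

lemma zmodReduction_eq_zero_of_nsmul_eq_zero {m n : ℕ} (hm : ¬ p ^ n ∣ m) (h : p ∣ p ^ n)
    {x : ZMod (p ^ n)} (hx : m • x = 0) : zmodReduction h x = 0 := by
  obtain ⟨x, rfl⟩ := ZMod.natCast_zmod_surjective x
  rw [nsmul_eq_mul, ← Nat.cast_mul, ZMod.natCast_eq_zero_iff] at hx
  rw [zmodReduction_apply, map_natCast, ZMod.natCast_eq_zero_iff]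
  by_contra hpx
  have hcop : (p ^ n).Coprime x := ((Fact.out : p.Prime).coprime_iff_not_dvd.2 hpx).pow_left n
  exact hm (hcop.dvd_of_dvd_mul_right hx)

variable {B : Type*} [AddCommGroup B] [TopologicalSpace B] [NonarchimedeanAddGroup B]
  [CompactSpace B]

lemma exists_padicResidue_comp_eq_of_torsion_le_ker
    (htor : IsClosed (AddCommGroup.torsion B : Set B)) (χ : B →L[ℤ] ZMod p)
    (hχ : ∀ b ∈ AddCommGroup.torsion B, χ b = 0) :
    ∃ φ : B →L[ℤ] ℤ_[p], (padicResidue p).comp φ = χ := by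
  let χ' : B ⧸ AddCommGroup.torsion B →L[ℤ] ZMod p :=
    ⟨(QuotientAddGroup.lift _ (χ : B →+ ZMod p) hχ).toIntLinearMap,
      χ.continuous.quotient_lift _⟩
  obtain ⟨φ, hφ⟩ := exists_padicResidue_comp_eq
    (fun b hb => (nsmul_eq_zero_iff_right (Fact.out : p.Prime).ne_zero).1 hb) χ'
  exact ⟨φ.comp ⟨(QuotientAddGroup.mk' _).toIntLinearMap, QuotientAddGroup.continuous_mk⟩,
    ContinuousLinearMap.ext fun b => DFunLike.congr_fun hφ (b : B ⧸ AddCommGroup.torsion B)⟩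

lemma exists_forall_ge_exists_padicResidue_comp_eq [T2Space B]
    (htor : IsClosed (AddCommGroup.torsion B : Set B)) :
    ∃ N, ∀ n ≥ N, ∀ f : B →L[ℤ] ZMod (p ^ (n + 1)), ∃ φ : B →L[ℤ] ℤ_[p],
      (padicResidue p).comp φ = (zmodReduction (dvd_pow_self p n.succ_ne_zero)).comp f := by
  have : CompactSpace (AddCommGroup.torsion B) := isCompact_iff_compactSpace.1 htor.isCompact
  obtain ⟨m, hm0, hm⟩ := exists_pos_forall_nsmul_eq_zero_of_isAddTorsion
    (A := AddCommGroup.torsion B) (AddCommMonoid.addTorsion.isAddTorsion (G := B))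
  refine ⟨m, fun n hn f => exists_padicResidue_comp_eq_of_torsion_le_ker htor _ fun c hc =>
    zmodReduction_eq_zero_of_nsmul_eq_zero (m := m) (fun hd => ?_)
      (dvd_pow_self p n.succ_ne_zero) ?_⟩
  · have hlt : n + 1 < p ^ (n + 1) := Nat.lt_pow_self (Fact.out : p.Prime).one_lt
    have := Nat.le_of_dvd hm0 hd
    lia
  · have hmc : m • c = 0 := congrArg Subtype.val (hm ⟨c, hc⟩)
    rw [← map_nsmul, hmc, map_zero]

end Torsion

lemma exists_linearIndepOn_forall_le_span_inter {K V : Type*} [DivisionRing K] [AddCommGroup V]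
    [Module K V] (l : ℕ) (W : ℕ → Submodule K V) (hW : Antitone W) :
    ∃ T : Set V, T ⊆ W 0 ∧ LinearIndepOn K id T ∧
      ∀ i ≤ l, W i ≤ Submodule.span K (T ∩ W i) := by
  induction l generalizing W with
  | zero =>
    obtain ⟨T, hTW, -, hspan, hli⟩ := exists_linearIndepOn_id_extension
      (linearIndepOn_empty K id) (Set.empty_subset (W 0 : Set V))
    refine ⟨T, hTW, hli, fun i hi => ?_⟩
    obtain rfl : i = 0 := Nat.le_zero.1 hi
    rwa [Set.inter_eq_left.2 hTW]
  | succ l ih =>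
    obtain ⟨T, hTW, hli, hspan⟩ := ih (fun i => W (i + 1)) fun i j h => hW (by lia)
    obtain ⟨T', hT'W, hTT', hspan', hli'⟩ :=
      exists_linearIndepOn_id_extension hli (hTW.trans (hW zero_le_one))
    refine ⟨T', hT'W, hli', fun i hi => ?_⟩
    cases i with
    | zero => rwa [Set.inter_eq_left.2 hT'W]
    | succ i =>
      exact (hspan i (by lia)).trans (Submodule.span_mono (Set.inter_subset_inter_left _ hTT'))

lemma exists_linearIndependent_level {K V : Type*} [DivisionRing K] [AddCommGroup V]
    [Module K V] (l : ℕ) (W : ℕ → Submodule K V) (hW : Antitone W) :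
    ∃ (T : Set V) (level : T → ℕ), LinearIndependent K ((↑) : T → V) ∧
      (∀ x, level x ≤ l ∧ (x : V) ∈ W (level x)) ∧
      ∀ i ≤ l, W i ≤ Submodule.span K ((↑) '' {x | i ≤ level x}) := by
  classical
  obtain ⟨T, hTW, hli, hspan⟩ := exists_linearIndepOn_forall_le_span_inter l W hW
  refine ⟨T, fun x => Nat.findGreatest (fun i => (x : V) ∈ W i) l, hli,
    fun x => ⟨Nat.findGreatest_le l, Nat.findGreatest_spec
      (P := fun i => (x : V) ∈ W i) (Nat.zero_le l) (hTW x.2)⟩,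
    fun i hi => (hspan i hi).trans (Submodule.span_mono ?_)⟩
  exact fun x hx => ⟨⟨x, hx.1⟩, Nat.le_findGreatest hi hx.2, rfl⟩

section LiftableHoms

variable {B : Type*} [AddCommGroup B] [TopologicalSpace B] {p : ℕ} [Fact p.Prime]

/-- The homomorphisms `B → ZMod p` which lift to a homomorphism `B → ZMod (p ^ (n + 1))` vanishing
on `S`. They filter the `ZMod p`-dual of `B`: a cyclic factor `ZMod (p ^ s)` contributes to the
first `s` steps only, and a factor `ℤ_[p]` to all of them. -/
def liftableHoms (B : Type*) [AddCommGroup B] [TopologicalSpace B] (p n : ℕ) [Fact p.Prime]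
    (S : Set B) : Submodule (ZMod p) (B →L[ℤ] ZMod p) where
  carrier := {χ | ∃ f : B →L[ℤ] ZMod (p ^ (n + 1)), (∀ b ∈ S, f b = 0) ∧
    (zmodReduction (dvd_pow_self p n.succ_ne_zero)).comp f = χ}
  zero_mem' := ⟨0, by simp, by simp⟩
  add_mem' := by
    rintro _ _ ⟨f, hf, rfl⟩ ⟨g, hg, rfl⟩
    exact ⟨f + g, fun b hb => by rw [add_apply, hf b hb, hg b hb, add_zero],
      ContinuousLinearMap.comp_add _ f g⟩
  smul_mem' := by
    rintro c _ ⟨f, hf, rfl⟩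
    refine ⟨c.val • f, fun b hb => by rw [smul_apply, hf b hb, smul_zero], ?_⟩
    ext b
    simp [nsmul_eq_mul]

lemma liftableHoms_antitone (S : Set B) : Antitone fun n => liftableHoms B p n S := by
  rintro m n hmn _ ⟨f, hf, rfl⟩
  have hdvd := pow_dvd_pow p (Nat.succ_le_succ hmn)
  refine ⟨(zmodReduction hdvd).comp f, fun b hb => ?_, ContinuousLinearMap.ext fun b =>
    zmodReduction_zmodReduction (dvd_pow_self p m.succ_ne_zero) hdvd (f b)⟩
  rw [ContinuousLinearMap.comp_apply, hf b hb, map_zero]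

lemma padicResidue_comp_mem_liftableHoms (n : ℕ) {S : Set B} {φ : B →L[ℤ] ℤ_[p]}
    (hφ : ∀ b ∈ S, φ b = 0) : (padicResidue p).comp φ ∈ liftableHoms B p n S :=
  ⟨(padicReduction p (n + 1)).comp φ,
    fun b hb => by rw [ContinuousLinearMap.comp_apply, hφ b hb, map_zero],
    ContinuousLinearMap.ext fun b => zmodReduction_padicReduction_succ n (φ b)⟩

lemma exists_zmodMulHom_comp_eq {m d n : ℕ} (h : m * d = n) (hd : d ≠ 0) (f : B →L[ℤ] ZMod n)
    (hf : (zmodReduction (Dvd.intro_left m h)).comp f = 0) :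
    ∃ g : B →L[ℤ] ZMod m, ∀ b, zmodMulHom h (g b) = f b := by
  have hex (b : B) : ∃ z, zmodMulHom h z = f b := by
    obtain ⟨y, hy⟩ := exists_nsmul_eq_of_zmodReduction_eq_zero (Dvd.intro_left m h)
      (DFunLike.congr_fun hf b)
    exact ⟨_, (zmodMulHom_castHom h y).trans hy⟩
  let i := Function.invFun (zmodMulHom h)
  have hi (b : B) : zmodMulHom h (i (f b)) = f b := Function.invFun_eq (hex b)
  let g : B →+ ZMod m := AddMonoidHom.mk' (fun b => i (f b)) fun a b =>
    zmodMulHom_injective h hd (by rw [hi, map_add (zmodMulHom h), hi, hi, map_add])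
  exact ⟨⟨g.toIntLinearMap, (continuous_of_discreteTopology (f := i)).comp f.continuous⟩, hi⟩

lemma eq_zero_of_forall_liftableHoms_le {S : Set B}
    (h : ∀ n, liftableHoms B p n ∅ ≤ liftableHoms B p n S) {b : B} (hb : b ∈ S) {n : ℕ}
    (f : B →L[ℤ] ZMod (p ^ n)) : f b = 0 := by
  induction n with
  | zero =>
    have : Subsingleton (ZMod (p ^ 0)) := by rw [pow_zero]; infer_instance
    exact Subsingleton.elim _ _
  | succ n ih =>
    let χ := (zmodReduction (dvd_pow_self p n.succ_ne_zero)).comp f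
    have hχ : χ ∈ liftableHoms B p n ∅ := ⟨f, by simp, rfl⟩
    -- `f` and a lift of `χ` vanishing on `S` differ by `p` times a homomorphism to `ZMod (p ^ n)`.
    obtain ⟨f', hf'S, hf'⟩ := h n hχ
    obtain ⟨g, hg⟩ := exists_zmodMulHom_comp_eq (pow_succ p n).symm
      (Fact.out : p.Prime).ne_zero (f - f') (by rw [ContinuousLinearMap.comp_sub, hf', sub_self])
    have hfb := hg b
    rwa [ih g, map_zero, sub_apply, hf'S b hb, sub_zero, eq_comm] at hfb

end LiftableHoms

section Surjectivity

lemma exists_forall_apply_eq_of_linearIndependent_of_finite {B : Type*} [AddCommGroup B] {p : ℕ}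
    [Fact p.Prime] {ι : Type*} [Finite ι] (χ : ι → B →+ ZMod p)
    (hχ : LinearIndependent (ZMod p) fun i b => χ i b) (x : ι → ZMod p) :
    ∃ b, ∀ i, χ i b = x i := by
  let R := AddSubgroup.toZModSubmodule p (AddMonoidHom.mk' (flip fun i b => χ i b) fun a b =>
    funext fun i => map_add (χ i) a b).range
  have hR : Submodule.span (ZMod p) (Set.range (flip fun i b => χ i b)) = R :=
    Submodule.span_eq R
  obtain ⟨b, hb⟩ : x ∈ R := by
    rw [← hR, span_flip_eq_top_iff_linearIndependent.2 hχ]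
    trivial
  exact ⟨b, congrFun hb⟩

variable {B : Type*} [AddCommGroup B] [TopologicalSpace B]

lemma exists_forall_apply_eq_of_linearIndependent [CompactSpace B] {p : ℕ} [Fact p.Prime]
    {ι : Type*} (χ : ι → B →L[ℤ] ZMod p) (hχ : LinearIndependent (ZMod p) χ) (x : ι → ZMod p) :
    ∃ b, ∀ i, χ i b = x i := by
  have hχ' : LinearIndependent (ZMod p) fun i b => χ i b :=
    hχ.map_injOn (⟨⟨DFunLike.coe, fun _ _ => rfl⟩, fun _ _ => rfl⟩ :
      (B →L[ℤ] ZMod p) →ₗ[ZMod p] B → ZMod p) DFunLike.coe_injective.injOn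
  obtain ⟨b, hb⟩ := CompactSpace.iInter_nonempty (t := fun i => χ i ⁻¹' {x i})
    (fun i => (isClosed_discrete _).preimage (χ i).continuous) fun s => by
      obtain ⟨b, hb⟩ := exists_forall_apply_eq_of_linearIndependent_of_finite
        (fun i : s => (χ i : B →+ ZMod p)) (hχ'.comp _ Subtype.val_injective) fun i => x i
      exact ⟨b, Set.mem_iInter₂.2 fun i hi => hb ⟨i, hi⟩⟩
  exact ⟨b, Set.mem_iInter.1 hb⟩

lemma surjective_of_surjective_mod [CompactSpace B] {P : Type*} [AddCommGroup P]
    [TopologicalSpace P] [IsTopologicalAddGroup P] [CompactSpace P] [T2Space P] (q : ℕ)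
    (hP : ∀ x : P, (∀ n, ∃ y, q ^ n • y = x) → x = 0) (Φ : B →L[ℤ] P)
    (hΦ : ∀ x, ∃ b y, x = Φ b + q • y) : Function.Surjective Φ := by
  intro x
  let E : ℕ → Set B := fun n => {b | ∃ y, q ^ n • y = x - Φ b}
  have hE_closed : ∀ n, IsClosed (E n) := fun n =>
    (isCompact_range (continuous_nsmul (q ^ n))).isClosed.preimage
      (continuous_const.sub Φ.continuous)
  have hE_nonempty : ∀ n, (E n).Nonempty := by
    intro n
    induction n with
    | zero => exact ⟨0, x, by simp⟩
    | succ n ih =>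
      obtain ⟨b, y, hy⟩ := ih
      obtain ⟨b', z, rfl⟩ := hΦ y
      refine ⟨b + q ^ n • b', z, ?_⟩
      rw [map_add, ← sub_sub, ← hy, map_nsmul, ← nsmul_sub, add_sub_cancel_left, pow_succ,
        mul_smul]
  obtain ⟨b, hb⟩ := IsCompact.nonempty_iInter_of_sequence_nonempty_isCompact_isClosed E
    (fun n b ⟨y, hy⟩ => ⟨q • y, by rw [← hy, pow_succ, mul_smul]⟩) hE_nonempty
    (hE_closed 0).isCompact hE_closed
  exact ⟨b, (sub_eq_zero.1 (hP _ (Set.mem_iInter.1 hb))).symm⟩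

variable {p : ℕ} [Fact p.Prime] {J I : Type*} {m : I → Type*} {s : I → ℕ}

lemma eq_zero_of_forall_exists_pow_nsmul_eq (x : (J → ℤ_[p]) × ((i : I) → m i → ZMod (p ^ s i)))
    (hx : ∀ n, ∃ y, p ^ n • y = x) : x = 0 := by
  refine Prod.ext (funext fun j => eq_of_forall_padicReduction_eq fun n => ?_)
    (funext fun i => funext fun e => ?_)
  · obtain ⟨y, rfl⟩ := hx n
    change padicReduction p n (p ^ n • y.1 j) = padicReduction p n 0
    rw [map_zero, map_nsmul, nsmul_eq_mul, ZMod.natCast_self, zero_mul]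
  · obtain ⟨y, rfl⟩ := hx (s i)
    change p ^ s i • y.2 i e = 0
    rw [nsmul_eq_mul, ZMod.natCast_self, zero_mul]

lemma surjective_prod_pi_of_linearIndependent [CompactSpace B] (hs : ∀ i, s i ≠ 0)
    (φ : J → B →L[ℤ] ℤ_[p]) (f : (i : I) → m i → B →L[ℤ] ZMod (p ^ s i))
    (h : LinearIndependent (ZMod p) (Sum.elim (fun j => (padicResidue p).comp (φ j))
      fun x : Σ i, m i => (zmodReduction (dvd_pow_self p (hs x.1))).comp (f x.1 x.2))) :
    Function.Surjective ((ContinuousLinearMap.pi φ).prod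
      (ContinuousLinearMap.pi fun i => ContinuousLinearMap.pi (f i))) := by
  refine surjective_of_surjective_mod p eq_zero_of_forall_exists_pow_nsmul_eq _ fun x => ?_
  obtain ⟨b, hb⟩ := exists_forall_apply_eq_of_linearIndependent _ h
    (Sum.elim (fun j => padicResidue p (x.1 j)) fun e =>
      zmodReduction (dvd_pow_self p (hs e.1)) (x.2 e.1 e.2))
  have hφ (j : J) : ∃ y, p • y = x.1 j - φ j b := exists_nsmul_eq_of_padicResidue_eq_zero <| by
    rw [map_sub, sub_eq_zero]
    exact (hb (Sum.inl j)).symm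
  have hf (i : I) (e : m i) : ∃ y, p • y = x.2 i e - f i e b :=
    exists_nsmul_eq_of_zmodReduction_eq_zero (dvd_pow_self p (hs i)) <| by
      rw [map_sub, sub_eq_zero]
      exact (hb (Sum.inr ⟨i, e⟩)).symm
  choose y hy using hφ
  choose z hz using hf
  exact ⟨b, (y, z), Prod.ext (funext fun j => (sub_eq_iff_eq_add'.1 (hy j).symm))
    (funext fun i => funext fun e => (sub_eq_iff_eq_add'.1 (hz i e).symm))⟩

end Surjectivity

section Structure

variable {B : Type u} [AddCommGroup B] [TopologicalSpace B] {p : ℕ} [Fact p.Prime]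

lemma exists_continuous_zmodHom_ne_zero [NonarchimedeanAddGroup B] [T2Space B]
    (hB : ∀ U : OpenAddSubgroup B, ∃ n, ∀ b : B, p ^ n • b ∈ U) {b : B} (hb : b ≠ 0) :
    ∃ (n : ℕ) (f : B →L[ℤ] ZMod (p ^ n)), f b ≠ 0 := by
  obtain ⟨U, hU⟩ := NonarchimedeanAddGroup.is_nonarchimedean {b}ᶜ
    (isOpen_compl_singleton.mem_nhds hb.symm)
  obtain ⟨n, hn⟩ := hB U
  let q := QuotientAddGroup.mk' U.toAddSubgroup
  have hQ : ∀ x : B ⧸ U.toAddSubgroup, p ^ n • x = 0 := fun x => by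
    obtain ⟨c, rfl⟩ := QuotientAddGroup.mk'_surjective _ x
    rw [← map_nsmul]
    exact (QuotientAddGroup.eq_zero_iff _).2 (hn c)
  have hqb : q b ≠ 0 := fun h => hU ((QuotientAddGroup.eq_zero_iff b).1 h) rfl
  obtain ⟨g, hg⟩ := exists_zmodHom_ne_zero hQ hqb
  have := QuotientAddGroup.discreteTopology U.isOpen
  exact ⟨n, ⟨(g.comp q).toIntLinearMap,
    (continuous_of_discreteTopology (f := g)).comp QuotientAddGroup.continuous_mk⟩, hg⟩

lemma liftableHoms_empty_le_of_level {ι : Type*} {e : ι → B →L[ℤ] ZMod p} {level : ι → ℕ}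
    {k l : ℕ} (hk : liftableHoms B p k ∅ = ⊤)
    (hspan : ∀ i ≤ l, liftableHoms B p (k + i) ∅ ≤
      Submodule.span (ZMod p) (e '' {x | i ≤ level x}))
    {S : Set B} (htop : ∀ x, l ≤ level x → ∀ n, e x ∈ liftableHoms B p n S)
    (hlevel : ∀ x, level x < l → e x ∈ liftableHoms B p (k + level x) S) (n : ℕ) :
    liftableHoms B p n ∅ ≤ liftableHoms B p n S := by
  have hn : liftableHoms B p n ∅ ≤ liftableHoms B p (k + min (n - k) l) ∅ := by
    rcases le_total n k with h | h
    · simp [Nat.sub_eq_zero_of_le h, hk]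
    · exact liftableHoms_antitone ∅ (by lia)
  refine (hn.trans (hspan _ (min_le_right _ _))).trans (Submodule.span_le.2 ?_)
  rintro _ ⟨x, hx : min (n - k) l ≤ level x, rfl⟩
  rcases le_or_gt l (level x) with h | h
  · exact htop x h n
  · exact liftableHoms_antitone S (by lia) (hlevel x h)

section AdaptedLifts

variable {ι : Type*} {e : ι → B →L[ℤ] ZMod p} {level : ι → ℕ} {k l : ℕ}
  {φ : {x // level x = l} → B →L[ℤ] ℤ_[p]}
  {f : (i : Fin l) → {x // level x = i} → B →L[ℤ] ZMod (p ^ (k + i + 1))}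

lemma injective_prod_pi_of_level [NonarchimedeanAddGroup B] [T2Space B]
    (hB : ∀ U : OpenAddSubgroup B, ∃ n, ∀ b : B, p ^ n • b ∈ U)
    (hk : liftableHoms B p k ∅ = ⊤) (hle : ∀ x, level x ≤ l)
    (hspan : ∀ i ≤ l, liftableHoms B p (k + i) ∅ ≤
      Submodule.span (ZMod p) (e '' {x | i ≤ level x}))
    (hφ : ∀ x, (padicResidue p).comp (φ x) = e x)
    (hf : ∀ (i : Fin l) x,
      (zmodReduction (dvd_pow_self p (k + i : ℕ).succ_ne_zero)).comp (f i x) = e x) :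
    Function.Injective ((ContinuousLinearMap.pi φ).prod
      (ContinuousLinearMap.pi fun i => ContinuousLinearMap.pi (f i))) := by
  let Φ := (ContinuousLinearMap.pi φ).prod
    (ContinuousLinearMap.pi fun i => ContinuousLinearMap.pi (f i))
  let S := {b | Φ b = 0}
  have hφS (x) (b) (hb : b ∈ S) : φ x b = 0 := congrFun (congrArg Prod.fst hb) x
  have hfS (i x) (b) (hb : b ∈ S) : f i x b = 0 :=
    congrFun (congrFun (congrArg Prod.snd hb) i) x
  have hS (n : ℕ) : liftableHoms B p n ∅ ≤ liftableHoms B p n S := by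
    refine liftableHoms_empty_le_of_level hk hspan (fun x hx n => ?_) (fun x hx => ?_) n
    · rw [← hφ ⟨x, (hle x).antisymm hx⟩]
      exact padicResidue_comp_mem_liftableHoms n (hφS _)
    · exact ⟨f ⟨_, hx⟩ ⟨x, rfl⟩, hfS _ _, hf _ _⟩
  refine (injective_iff_map_eq_zero Φ).2 fun b hb => by_contra fun hb0 => ?_
  obtain ⟨n, g, hg⟩ := exists_continuous_zmodHom_ne_zero hB hb0
  exact hg (eq_zero_of_forall_liftableHoms_le hS hb g)

lemma surjective_prod_pi_of_level [CompactSpace B] (he : LinearIndependent (ZMod p) e)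
    (hφ : ∀ x, (padicResidue p).comp (φ x) = e x)
    (hf : ∀ (i : Fin l) x,
      (zmodReduction (dvd_pow_self p (k + i : ℕ).succ_ne_zero)).comp (f i x) = e x) :
    Function.Surjective ((ContinuousLinearMap.pi φ).prod
      (ContinuousLinearMap.pi fun i => ContinuousLinearMap.pi (f i))) := by
  let index : {x // level x = l} ⊕ (Σ i : Fin l, {x // level x = i}) → ι :=
    Sum.elim Subtype.val fun x => x.2
  have hindex : Function.Injective index := by
    rintro (⟨x, hx⟩ | ⟨i, x, hx⟩) (⟨y, hy⟩ | ⟨j, y, hy⟩) (rfl : x = y)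
    · rfl
    · exact absurd (hx.symm.trans hy) j.2.ne'
    · exact absurd (hx.symm.trans hy) i.2.ne
    · obtain rfl : i = j := Fin.ext (hx.symm.trans hy)
      rfl
  refine surjective_prod_pi_of_linearIndependent (s := fun i : Fin l => k + i + 1)
    (fun i => (k + i : ℕ).succ_ne_zero) φ f ?_
  convert he.comp index hindex using 1
  exact funext (Sum.rec hφ fun x => hf x.1 x.2)

end AdaptedLifts

theorem exists_bijective_prod_pi [NonarchimedeanAddGroup B] [CompactSpace B] [T2Space B]
    (hB : ∀ U : OpenAddSubgroup B, ∃ n, ∀ b : B, p ^ n • b ∈ U)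
    (htor : IsClosed (AddCommGroup.torsion B : Set B)) {k : ℕ}
    (hk : liftableHoms B p k ∅ = ⊤) :
    ∃ (J : Type u) (l : ℕ) (m : Fin l → Type u) (s : Fin l → ℕ),
      StrictMono s ∧ (∀ i, k + 1 ≤ s i) ∧
      ∃ Φ : B →L[ℤ] (J → ℤ_[p]) × ((i : Fin l) → m i → ZMod (p ^ s i)), Function.Bijective Φ := by
  obtain ⟨l, hl⟩ := exists_forall_ge_exists_padicResidue_comp_eq (p := p) htor
  obtain ⟨T, level, hli, hlevel, hspan⟩ := exists_linearIndependent_level l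
    (fun i => liftableHoms B p (k + i) ∅) fun i j h => liftableHoms_antitone ∅ (by lia)
  have hφ (x : {x // level x = l}) : ∃ φ : B →L[ℤ] ℤ_[p], (padicResidue p).comp φ = x.1 := by
    obtain ⟨f, -, hf⟩ := (hlevel x).2
    obtain ⟨φ, hφ⟩ := hl (k + level x) (by lia) f
    exact ⟨φ, hφ.trans hf⟩
  have hf (i : Fin l) (x : {x // level x = i}) : ∃ f : B →L[ℤ] ZMod (p ^ (k + i + 1)),
      (zmodReduction (dvd_pow_self p (k + i : ℕ).succ_ne_zero)).comp f = x.1 := by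
    obtain ⟨f, -, hf⟩ := x.2 ▸ (hlevel x).2
    exact ⟨f, hf⟩
  choose φ hφ using hφ
  choose f hf using hf
  exact ⟨{x // level x = l}, l, fun i => {x // level x = i}, fun i => k + i + 1,
    fun i j h => by simpa using h, fun i => by lia, _,
    injective_prod_pi_of_level hB hk (fun x => (hlevel x).1) hspan hφ hf,
    surjective_prod_pi_of_level hli hφ hf⟩

end Structure

section ZModPow

variable {G : Type*} [CommGroup G] {n : ℕ} {u : G}

/-- The homomorphism `i ↦ u ^ i`, where `u ^ n = 1`, from the cyclic group of order `n` written
multiplicatively. -/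
def zmodPowHom (hu : u ^ n = 1) : Multiplicative (ZMod n) →* G :=
  AddMonoidHom.toMultiplicativeLeft (ZMod.lift n ⟨zmultiplesHom (Additive G) (.ofMul u), by
    rw [zmultiplesHom_apply, natCast_zsmul, ← ofMul_pow, hu, ofMul_one]⟩)

lemma zmodPowHom_intCast (hu : u ^ n = 1) (i : ℤ) : zmodPowHom hu (.ofAdd (i : ZMod n)) = u ^ i :=
  congrArg Additive.toMul (ZMod.lift_coe n _ i)

lemma zmodPowHom_apply_pow (hu : u ^ n = 1) (x : Multiplicative (ZMod n)) :
    zmodPowHom hu x ^ n = 1 := by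
  obtain ⟨i, hi⟩ := ZMod.intCast_surjective x.toAdd
  obtain rfl : x = .ofAdd (i : ZMod n) := congrArg Multiplicative.ofAdd hi.symm
  rw [zmodPowHom_intCast, ← zpow_natCast, zpow_comm, zpow_natCast, hu, one_zpow]

lemma zmodPowHom_injective (hu : IsPrimitiveRoot u n) :
    Function.Injective (zmodPowHom hu.pow_eq_one) := by
  refine (injective_iff_map_eq_one _).2 fun x hx => ?_
  obtain ⟨i, hi⟩ := ZMod.intCast_surjective x.toAdd
  obtain rfl : x = .ofAdd (i : ZMod n) := congrArg Multiplicative.ofAdd hi.symm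
  rw [zmodPowHom_intCast, hu.zpow_eq_one_iff_dvd, ← ZMod.intCast_zmod_eq_zero_iff_dvd] at hx
  rw [hx, ofAdd_zero]

lemma zmodPowHom_pow_eq_zmodReduction {m d : ℕ} (h : m * d = n) (hu : u ^ n = 1)
    (hud : (u ^ d) ^ m = 1) (x : Multiplicative (ZMod n)) : zmodPowHom hu x ^ d =
      zmodPowHom hud (.ofAdd (zmodReduction (Dvd.intro d h) x.toAdd)) := by
  obtain ⟨i, hi⟩ := ZMod.intCast_surjective x.toAdd
  obtain rfl : x = .ofAdd (i : ZMod n) := congrArg Multiplicative.ofAdd hi.symm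
  have hred : zmodReduction (Dvd.intro d h) (i : ZMod n) = (i : ZMod m) :=
    map_intCast (ZMod.castHom (Dvd.intro d h) (ZMod m)) i
  rw [toAdd_ofAdd, hred, zmodPowHom_intCast, zmodPowHom_intCast, ← zpow_natCast, ← zpow_natCast,
    zpow_comm]

end ZModPow

section Kummer

variable {F K : Type*} [Field F] [Field K] [Algebra F K]

lemma exists_forall_apply_eq_character_mul_of_finiteDimensional [FiniteDimensional F K]
    (ρ : Gal(K/F) →* Fˣ) : ∃ β : Kˣ, ∀ σ : Gal(K/F), σ β = algebraMap F K (ρ σ) * β := by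
  have hρ : groupCohomology.IsMulCocycle₁ fun σ => Units.map (algebraMap F K).toMonoidHom (ρ σ) :=
    fun σ τ => by
      have hσ : σ • Units.map (algebraMap F K).toMonoidHom (ρ τ) = Units.map _ (ρ τ) :=
        Units.ext (σ.commutes _)
      simp only [hσ, map_mul, mul_comm]
  obtain ⟨β, hβ⟩ := groupCohomology.isMulCoboundary₁_of_isMulCocycle₁_of_aut_to_units _ hρ
  exact ⟨β, fun σ => congrArg Units.val (div_eq_iff_eq_mul.1 (hβ σ))⟩

lemma exists_comp_restrictNormalHom_eq [IsGalois F K] {M : Type*} [Group M] (ρ : Gal(K/F) →* M)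
    (hρ : IsOpen (ρ.ker : Set Gal(K/F))) :
    ∃ (E : IntermediateField F K) (_ : FiniteDimensional F E) (_ : IsGalois F E)
      (ρE : Gal(E/F) →* M), ρE.comp (AlgEquiv.restrictNormalHom E) = ρ := by
  let H : ClosedSubgroup Gal(K/F) := ⟨ρ.ker, Subgroup.isClosed_of_isOpen _ hρ⟩
  let E : IntermediateField F K := IntermediateField.fixedField H.1
  have hE : E.fixingSubgroup = ρ.ker := InfiniteGalois.fixingSubgroup_fixedField H
  obtain ⟨hfin, hgal⟩ := (InfiniteGalois.isOpen_and_normal_iff_finite_and_isGalois E).1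
    ⟨by rw [hE]; exact hρ, by rw [hE]; infer_instance⟩
  have hsurj := AlgEquiv.restrictNormalHom_surjective (F := F) (K₁ := E) K
  have hker : (AlgEquiv.restrictNormalHom (K₁ := K) E).ker ≤ ρ.ker := by
    rw [IntermediateField.restrictNormalHom_ker, hE]
  exact ⟨E, hfin, hgal, MonoidHom.liftOfSurjective _ hsurj ⟨ρ, hker⟩,
    MonoidHom.liftOfRightInverse_comp _ _ _ _⟩

lemma exists_forall_apply_eq_character_mul [IsGalois F K] (ρ : Gal(K/F) →* Fˣ)
    (hρ : IsOpen (ρ.ker : Set Gal(K/F))) :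
    ∃ β : Kˣ, ∀ σ : Gal(K/F), σ β = algebraMap F K (ρ σ) * β := by
  obtain ⟨E, _, _, ρE, rfl⟩ := exists_comp_restrictNormalHom_eq ρ hρ
  obtain ⟨β, hβ⟩ := exists_forall_apply_eq_character_mul_of_finiteDimensional ρE
  refine ⟨Units.map (algebraMap E K) β, fun σ => ?_⟩
  exact (AlgEquiv.restrictNormalHom_apply E σ β).symm.trans
    (congrArg (algebraMap E K) (hβ (AlgEquiv.restrictNormalHom E σ)))

lemma exists_kummerCharacter [Algebra.IsIntegral F K] {n : ℕ} [NeZero n] {ζ : Fˣ}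
    (hζ : IsPrimitiveRoot ζ n) {α : K} (hα0 : α ≠ 0) (hα : ∀ σ : Gal(K/F), σ α ^ n = α ^ n) :
    ∃ ψ : Gal(K/F) →* Multiplicative (ZMod n), IsOpen (ψ.ker : Set Gal(K/F)) ∧
      ∀ σ : Gal(K/F), σ α = algebraMap F K (zmodPowHom hζ.pow_eq_one (ψ σ)) * α := by
  have hζK : IsPrimitiveRoot (algebraMap F K ζ) n :=
    (IsPrimitiveRoot.coe_units_iff.2 hζ).map_of_injective (algebraMap F K).injective
  have hex (σ : Gal(K/F)) : ∃ x, σ α = algebraMap F K (zmodPowHom hζ.pow_eq_one x) * α := by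
    obtain ⟨i, -, hi⟩ := hζK.eq_pow_of_pow_eq_one (ξ := σ α / α) (by
      rw [div_pow, hα, div_self (pow_ne_zero n hα0)])
    refine ⟨.ofAdd ((i : ℤ) : ZMod n), ?_⟩
    rw [zmodPowHom_intCast, zpow_natCast, Units.val_pow_eq_pow_val, map_pow, hi,
      div_mul_cancel₀ _ hα0]
  choose ψ hψ using hex
  have hinj {x y} (h : algebraMap F K (zmodPowHom hζ.pow_eq_one x) * α =
      algebraMap F K (zmodPowHom hζ.pow_eq_one y) * α) : x = y :=
    zmodPowHom_injective hζ (Units.ext ((algebraMap F K).injective (mul_right_cancel₀ hα0 h)))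
  refine ⟨MonoidHom.mk' ψ fun σ τ => hinj ?_,
    Subgroup.isOpen_mono (fun σ hσ => ?_) (stabilizer_isOpen_of_isIntegral α), hψ⟩
  · rw [← hψ, AlgEquiv.mul_apply, hψ τ, map_mul, AlgEquiv.commutes, hψ σ, map_mul, Units.val_mul,
      map_mul, mul_left_comm, mul_assoc]
  · have hσα : σ α = α := hσ
    exact hinj (x := ψ σ) (by rw [← hψ, hσα, map_one, Units.val_one, map_one, one_mul])

lemma exists_zmodReduction_eq_of_isPrimitiveRoot [IsGalois F K] [IsSepClosed K] {m d n : ℕ}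
    [NeZero n] (h : m * d = n) {ζ : Fˣ} (hζ : IsPrimitiveRoot ζ n)
    (χ : Gal(K/F) →* Multiplicative (ZMod m)) (hχ : IsOpen (χ.ker : Set Gal(K/F))) :
    ∃ ψ : Gal(K/F) →* Multiplicative (ZMod n), IsOpen (ψ.ker : Set Gal(K/F)) ∧
      ∀ σ, zmodReduction (Dvd.intro d h) (ψ σ).toAdd = (χ σ).toAdd := by
  have hζd : IsPrimitiveRoot (ζ ^ d) m :=
    hζ.pow (NeZero.pos n) (by rw [← h, mul_comm])
  let ρ := (zmodPowHom hζd.pow_eq_one).comp χ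
  have hρ : IsOpen (ρ.ker : Set Gal(K/F)) := Subgroup.isOpen_mono (fun σ hσ => by
    rw [MonoidHom.mem_ker, MonoidHom.comp_apply, hσ, map_one]) hχ
  have hρm (σ) : ρ σ ^ m = 1 := zmodPowHom_apply_pow hζd.pow_eq_one (χ σ)
  -- If `σ β = ρ σ * β` for all `σ`, then the Kummer character of a `d`-th root of `β` lifts `χ`.
  obtain ⟨β, hβ⟩ := exists_forall_apply_eq_character_mul ρ hρ
  have hn : NeZero (n : K) := ((IsPrimitiveRoot.coe_units_iff.2 hζ).map_of_injective
    (algebraMap F K).injective).neZero'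
  rw [← h, Nat.cast_mul] at hn
  have hd : NeZero (d : K) := ⟨right_ne_zero_of_mul hn.out⟩
  have hd0 : d ≠ 0 := fun h => hd.out (by rw [h, Nat.cast_zero])
  obtain ⟨α, hα⟩ := IsSepClosed.exists_pow_nat_eq (β : K) d
  have hσα (σ : Gal(K/F)) : σ α ^ d = algebraMap F K (ρ σ) * β := by rw [← map_pow, hα, hβ]
  obtain ⟨ψ, hψ_open, hψ⟩ := exists_kummerCharacter hζ (α := α)
    (ne_zero_pow hd0 (hα ▸ β.ne_zero)) fun σ => by
      rw [← h, mul_comm, pow_mul, hσα, pow_mul, hα, mul_pow, ← map_pow, ← Units.val_pow_eq_pow_val,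
        hρm, Units.val_one, map_one, one_mul]
  refine ⟨ψ, hψ_open, fun σ => ?_⟩
  have hψρ : zmodPowHom hζ.pow_eq_one (ψ σ) ^ d = ρ σ := by
    refine Units.ext ((algebraMap F K).injective (mul_right_cancel₀ β.ne_zero ?_))
    rw [← hσα, hψ, mul_pow, hα, Units.val_pow_eq_pow_val, map_pow]
  rw [zmodPowHom_pow_eq_zmodReduction h hζ.pow_eq_one hζd.pow_eq_one] at hψρ
  exact congrArg Multiplicative.toAdd (zmodPowHom_injective hζd hψρ)

end Kummer

section ProPQuotient

variable {G : Type*} [Group G] [TopologicalSpace G]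

instance nonarchimedeanGroup_quotient [NonarchimedeanGroup G] (N : Subgroup G) [N.Normal] :
    NonarchimedeanGroup (G ⧸ N) :=
  nonarchimedeanGroup_of_isOpenMap (QuotientGroup.mk' N) QuotientGroup.continuous_mk
    QuotientGroup.isOpenMap_coe

instance nonarchimedeanGroup_gal (K L : Type*) [Field K] [Field L] [Algebra K L] :
    NonarchimedeanGroup Gal(L/K) where
  is_nonarchimedean V hV := by
    obtain ⟨E, hE, hEV⟩ := (krullTopology_mem_nhds_one_iff K L V).1 hV
    exact ⟨⟨E.fixingSubgroup, E.fixingSubgroup_isOpen⟩, hEV⟩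

instance nonarchimedeanAddGroup_additive [NonarchimedeanGroup G] :
    NonarchimedeanAddGroup (Additive G) where
  is_nonarchimedean V hV := by
    obtain ⟨U, hU⟩ := NonarchimedeanGroup.is_nonarchimedean (Additive.ofMul ⁻¹' V) hV
    exact ⟨⟨U.toSubgroup.toAddSubgroup, U.isOpen⟩, hU⟩

lemma exists_forall_pow_mem_of_proPKernel_subset [IsTopologicalGroup G] [CompactSpace G] (p : ℕ)
    {V : Set G} (hV : IsOpen V) (h : (proPKernel p G : Set G) ⊆ V) :
    ∃ n, ∀ g : G, g ^ p ^ n ∈ V := by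
  classical
  rw [proPKernel, Subgroup.coe_iInf, ← Set.disjoint_compl_left_iff_subset,
    Set.disjoint_iff_inter_eq_empty] at h
  obtain ⟨t, ht⟩ := hV.isClosed_compl.isCompact.elim_finite_subfamily_closed _
    (fun U => Subgroup.isClosed_of_isOpen _ U.1.isOpen') h
  choose n hn using fun U : {U : OpenNormalSubgroup G // ∃ n, (U : Subgroup G).index = p ^ n} =>
    U.2
  refine ⟨∑ U ∈ t, n U, fun g => ?_⟩
  by_contra hg
  refine Set.notMem_empty (g ^ p ^ ∑ U ∈ t, n U) (ht ▸ ⟨hg, Set.mem_iInter₂.2 fun U hU => ?_⟩)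
  have := U.1.isNormal'
  rw [← Finset.add_sum_erase t n hU, pow_add, pow_mul, ← hn U]
  exact Subgroup.pow_mem _ (Subgroup.pow_index_mem _ g) _

lemma proPKernel_le_ker_of_isOpen {p n : ℕ} [Fact p.Prime]
    (ψ : G →* Multiplicative (ZMod (p ^ n))) (hψ : IsOpen (ψ.ker : Set G)) :
    proPKernel p G ≤ ψ.ker := by
  have hdvd : ψ.ker.index ∣ p ^ n := by
    rw [Subgroup.index_ker]
    simpa only [Nat.card_eq_fintype_card, Fintype.card_multiplicative, ZMod.card] using
      Subgroup.card_subgroup_dvd_card ψ.range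
  obtain ⟨m, -, hm⟩ := (Nat.dvd_prime_pow Fact.out).1 hdvd
  exact iInf_le (fun U : {U : OpenNormalSubgroup G // ∃ n, (U : Subgroup G).index = p ^ n} =>
    (U.1 : Subgroup G)) ⟨⟨⟨ψ.ker, hψ⟩, inferInstance⟩, m, hm⟩

variable [IsTopologicalGroup G]

/-- The projection from `G` to the topological abelianization of its maximal pro-`p` quotient. -/
def toProPAb (p : ℕ) (G : Type*) [Group G] [TopologicalSpace G] [IsTopologicalGroup G] :
    G →* TopologicalAbelianization (MaximalProPQuotient p G) :=
  (QuotientGroup.mk' _).comp (QuotientGroup.mk' _)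

lemma toProPAb_surjective (p : ℕ) : Function.Surjective (toProPAb p G) :=
  (QuotientGroup.mk'_surjective _).comp (QuotientGroup.mk'_surjective _)

lemma toProPAb_continuous (p : ℕ) : Continuous (toProPAb p G) :=
  QuotientGroup.continuous_mk.comp QuotientGroup.continuous_mk

lemma exists_forall_pow_mem_proPAb [CompactSpace G] (p : ℕ)
    {U : Set (TopologicalAbelianization (MaximalProPQuotient p G))} (hU : IsOpen U)
    (h1 : 1 ∈ U) : ∃ n, ∀ a, a ^ p ^ n ∈ U := by
  obtain ⟨n, hn⟩ := exists_forall_pow_mem_of_proPKernel_subset p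
    (hU.preimage (toProPAb_continuous p)) fun g hg => by
      have hg1 : QuotientGroup.mk' (proPKernel p G) g = 1 := (QuotientGroup.eq_one_iff g).2 hg
      rwa [Set.mem_preimage, toProPAb, MonoidHom.comp_apply, hg1, map_one]
  refine ⟨n, fun a => ?_⟩
  obtain ⟨g, rfl⟩ := toProPAb_surjective p a
  exact map_pow (toProPAb p G) g _ ▸ hn g

lemma exists_proPAb_hom_comp_eq {p n : ℕ} [Fact p.Prime]
    (ψ : G →* Multiplicative (ZMod (p ^ n))) (hψ : IsOpen (ψ.ker : Set G)) :
    ∃ f : Additive (TopologicalAbelianization (MaximalProPQuotient p G)) →L[ℤ] ZMod (p ^ n),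
      ∀ g, f (.ofMul (toProPAb p G g)) = (ψ g).toAdd := by
  let ψ₁ := QuotientGroup.lift _ ψ (proPKernel_le_ker_of_isOpen ψ hψ)
  have hψ₁ : Continuous ψ₁ := QuotientGroup.isOpenQuotientMap_mk.isQuotientMap.continuous_iff.2
    (monoidHom_continuous_of_isOpen_ker ψ hψ)
  let ψ₂ := QuotientGroup.lift _ ψ₁ (Subgroup.topologicalClosure_minimal _
    (Abelianization.commutator_subset_ker ψ₁) (isClosed_singleton.preimage hψ₁))
  have hψ₂ : Continuous ψ₂ :=
    QuotientGroup.isOpenQuotientMap_mk.isQuotientMap.continuous_iff.2 hψ₁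
  exact ⟨⟨(MonoidHom.toAdditiveLeft ψ₂).toIntLinearMap, hψ₂⟩, fun _ => rfl⟩

end ProPQuotient

theorem exists_continuousMulEquiv_prod_pi {A : Type u} [CommGroup A] [TopologicalSpace A]
    [NonarchimedeanGroup A] [CompactSpace A] [T2Space A] {p : ℕ} [Fact p.Prime]
    (hA : ∀ U : Set A, IsOpen U → 1 ∈ U → ∃ n, ∀ a : A, a ^ p ^ n ∈ U)
    (htor : IsClosed (CommGroup.torsion A : Set A)) {k : ℕ}
    (hk : liftableHoms (Additive A) p k ∅ = ⊤) :
    ∃ (J : Type u) (l : ℕ) (m : Fin l → Type u) (s : Fin l → ℕ),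
      StrictMono s ∧ (∀ i, k + 1 ≤ s i) ∧
      Nonempty (A ≃ₜ* Multiplicative ((J → ℤ_[p]) × ((i : Fin l) → m i → ZMod (p ^ s i)))) := by
  have : T2Space (Additive A) := ‹T2Space A›
  have htor' : IsClosed (AddCommGroup.torsion (Additive A) : Set (Additive A)) := by
    have h : (AddCommGroup.torsion (Additive A) : Set (Additive A)) =
        Additive.toMul ⁻¹' (CommGroup.torsion A : Set A) :=
      Set.ext fun a => isOfFinAddOrder_ofMul_iff (x := a.toMul)
    rw [h]
    exact htor.preimage continuous_toMul
  have hB (U : OpenAddSubgroup (Additive A)) : ∃ n, ∀ b : Additive A, p ^ n • b ∈ U :=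
    hA (Additive.ofMul ⁻¹' U) (U.isOpen.preimage continuous_ofMul) U.zero_mem
  obtain ⟨J, l, m, s, hs, hks, Φ, hΦ⟩ := exists_bijective_prod_pi hB htor' hk
  let e := AddEquiv.ofBijective Φ hΦ
  have he : Continuous e := Φ.continuous
  exact ⟨J, l, m, s, hs, hks, ⟨{ AddEquiv.toMultiplicativeRight e with
    continuous_toFun := he
    continuous_invFun := he.continuous_symm_of_equiv_compact_to_t2 (f := e.toEquiv) }⟩⟩

lemma liftableHoms_proPAb_eq_top {p k : ℕ} [Fact p.Prime] {F : Type*} [Field F] {ζ : F}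
    (hζ : IsPrimitiveRoot ζ (p ^ (k + 1))) :
    liftableHoms (Additive (maximalProPGaloisGroupAb p F)) p k ∅ = ⊤ := by
  refine eq_top_iff.2 fun χ _ => ?_
  let χ' : Gal(SeparableClosure F/F) →* Multiplicative (ZMod p) :=
    (AddMonoidHom.toMultiplicativeRight χ.toLinearMap.toAddMonoidHom).comp (toProPAb p _)
  obtain ⟨ψ, hψ, hψχ⟩ := exists_zmodReduction_eq_of_isPrimitiveRoot (pow_succ' p k).symm
    (hζ.isUnit_unit (NeZero.ne _)) χ'
    ((isOpen_discrete {0}).preimage (χ.continuous.comp (toProPAb_continuous p)))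
  obtain ⟨f, hf⟩ := exists_proPAb_hom_comp_eq ψ hψ
  refine ⟨f, fun _ => False.elim, ContinuousLinearMap.ext fun b => ?_⟩
  obtain ⟨g, hg⟩ := toProPAb_surjective p b.toMul
  obtain rfl : b = .ofMul (toProPAb p _ g) := hg.symm
  exact (congrArg _ (hf g)).trans (hψχ g)

theorem theorem4p6 (p : ℕ) [Fact p.Prime] (F : Type u) [Field F] (k : ℕ) (hk : 1 ≤ k)
    (hζ : ∃ ζ : F, IsPrimitiveRoot ζ (p ^ k))
    (htor : IsClosed (CommGroup.torsion (maximalProPGaloisGroupAb p F) :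
      Set (maximalProPGaloisGroupAb p F))) :
    ∃ (J : Type u) (l : ℕ) (m : Fin l → Type u) (s : Fin l → ℕ),
      StrictMono s ∧ (∀ i, k ≤ s i) ∧
      Nonempty (maximalProPGaloisGroupAb p F ≃ₜ*
        Multiplicative ((J → ℤ_[p]) × ((i : Fin l) → m i → ZMod (p ^ s i)))) := by
  obtain ⟨k, rfl⟩ := Nat.exists_eq_add_of_le' hk
  obtain ⟨ζ, hζ⟩ := hζ
  have : IsClosed ((commutator (maximalProPGaloisGroup p F)).topologicalClosure :
    Set (maximalProPGaloisGroup p F)) := Subgroup.isClosed_topologicalClosure _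
  exact exists_continuousMulEquiv_prod_pi (fun _ => exists_forall_pow_mem_proPAb p) htor
    (liftableHoms_proPAb_eq_top hζ)
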